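/- Let $p$ be a prime, $r\ge 1$, and $R=\mathbb{Z}_{p^r}=\mathbb{Z}/p^r\mathbb{Z}$. A free convolutional code of length $n$ and rank $k$ over $R$ is a submodule $\mathcal{C}\subseteq R((D))^n$ of the form $$\mathcal{C}=\{u(D)G(D) : u(D)\in R((D))^k\},$$ where $G(D)\in R[D]^{k\times n}$ is a polynomial matrix of full rank, i.e. its rows are linearly independent over $R((D))$; every such $G(D)$ is called an encoder of $\mathcal{C}$. The weight $\mathrm{wt}[u(D)]\in\mathbb{N}\cup\{\infty\}$ of a vector of Laurent series is the total number of nonzero coefficients of its components. An encoder $G(D)$ is non-catastrophic if for all $u(D)\in R((D))^k$ $$\mathrm{wt}[u(D)G(D)]<\infty\iff \mathrm{wt}[u(D)]<\infty,$$ and catastrophic otherwise. A free convolutional code is called catastrophic if every encoder of it is catastrophic. The dual of $\mathcal{C}$ is $$\mathcal{C}^\perp=\{v(D)\in R((D))^n : v(D)\,w(D)^T=0 \text{ for all } w(D)\in\mathcal{C}\}.$$ Let $\mathcal{C}$ be a free convolutional code of length $n$ and rank $k$ over $\mathbb{Z}_{p^r}$. Then $\mathcal{C}^\perp$ is a free convolutional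 code of length $n$ and rank $n-k$, and $\mathcal{C}$ is catastrophic if and only if $\mathcal{C}^\perp$ is catastrophic. -/

import Mathlib

open Polynomial
open scoped LaurentSeries PowerSeries Matrix

noncomputable section

namespace ConvCode

variable {R : Type*} [CommRing R] {k n : ℕ}

/-- A polynomial matrix in the delay variable `D`, regarded as a matrix of Laurent series. -/
def laurentMatrix (G : Matrix (Fin k) (Fin n) R[X]) : Matrix (Fin k) (Fin n) R⸨X⸩ :=
  G.map fun f => ((f : R⟦X⟧) : R⸨X⸩)

/-- The Hamming weight of a vector of Laurent series: the total number of nonzero coefficients of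
its components, an element of `ℕ ∪ {∞}`. -/
def wt {m : ℕ} (u : Fin m → R⸨X⸩) : ℕ∞ :=
  ∑ i, {j : ℤ | (u i).coeff j ≠ 0}.encard

/-- The polynomial matrix `G` is a generator matrix (encoder) of `C`: it has full rank, i.e. its
rows are linearly independent over the ring of Laurent series, and `C` is the set of all
`u(D) G(D)`, where `u(D)` is a row vector of Laurent series. -/
def IsEncoder (G : Matrix (Fin k) (Fin n) R[X]) (C : Submodule R⸨X⸩ (Fin n → R⸨X⸩)) : Prop :=
  LinearIndependent R⸨X⸩ (fun i => laurentMatrix G i) ∧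
    ∀ v : Fin n → R⸨X⸩, v ∈ C ↔ ∃ u : Fin k → R⸨X⸩, v = u ᵥ* laurentMatrix G

/-- `C` is a free convolutional code of length `n` and rank `k`. -/
def IsFreeCode (k : ℕ) (C : Submodule R⸨X⸩ (Fin n → R⸨X⸩)) : Prop :=
  ∃ G : Matrix (Fin k) (Fin n) R[X], IsEncoder G C

/-- The encoder `G` is non-catastrophic: `u G` has finite weight exactly when `u` has. -/
def IsNoncatastrophicEncoder (G : Matrix (Fin k) (Fin n) R[X]) : Prop :=
  ∀ u : Fin k → R⸨X⸩, wt (u ᵥ* laurentMatrix G) < ⊤ ↔ wt u < ⊤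

/-- A code is catastrophic if all its encoders are catastrophic. -/
def IsCatastrophic (C : Submodule R⸨X⸩ (Fin n → R⸨X⸩)) : Prop :=
  ∀ (k : ℕ) (G : Matrix (Fin k) (Fin n) R[X]), IsEncoder G C → ¬ IsNoncatastrophicEncoder G

/-- The dual code: all vectors of Laurent series that are orthogonal to every codeword. -/
def dual (C : Submodule R⸨X⸩ (Fin n → R⸨X⸩)) : Submodule R⸨X⸩ (Fin n → R⸨X⸩) where
  carrier := {v | ∀ w ∈ C, v ⬝ᵥ w = 0}
  add_mem' := by
    intro a b ha hb w hw
    rw [add_dotProduct, ha w hw, hb w hw, add_zero]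
  zero_mem' := by
    intro w _
    exact zero_dotProduct w
  smul_mem' := by
    intro c a ha w hw
    rw [smul_dotProduct, ha w hw, smul_zero]

end ConvCode

end

/-! Everything is transported through the residue map `φ` from `ℤ/p^r` to the field `𝔽_p`.
Multiplication by `s = p^(r-1)` kills exactly `ker φ`, so it copies series over `𝔽_p` into `R⸨X⸩`
with the same support (`support_C_mul_eq`). Hence full rank, and saturation up to powers of `X` in
the noncatastrophic case, pass to the reduced encoder.

Over the principal ideal domain `𝔽_p[X]` the reduced encoder is completed to a square matrix with
nonzero determinant, dividing a power of `X` in the noncatastrophic case. As `ker φ` is nilpotent,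
any lift `W` that contains the encoder has determinant a unit in `R⸨X⸩`, respectively a divisor of a
power of `X`.

Since `W * adj W = det W`, the complementary columns of `adj W` give an encoder of the dual,
noncatastrophic if `det W` divides a power of `X`. The converse follows from `dual (dual C) = C`. -/

noncomputable section

namespace ConvCode

/-! ### Completing independent rows to a square matrix over a principal ideal domain. -/

section Completion

variable {P : Type*} [CommRing P] [IsDomain P] [IsPrincipalIdealRing P]

/-- A linearly independent family in a free module over a principal ideal domain extends to a
family of full rank; the multipliers needed to move every vector into its span are those needed
for the vectors of the saturation of the given family. -/
theorem exists_extension {k n : ℕ} (g : Fin k → Fin n → P) (hg : LinearIndependent P g)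
    (M : Submonoid P)
    (hM : ∀ (x : Fin n → P) (d : P), d ≠ 0 → d • x ∈ Submodule.span P (Set.range g) →
      ∃ c ∈ M, c • x ∈ Submodule.span P (Set.range g)) :
    ∃ (m : ℕ) (h : Fin m → Fin n → P), k + m = n ∧
      ∀ x : Fin n → P, ∃ c ∈ M, c • x ∈ Submodule.span P (Set.range (Sum.elim g h)) := by
  set N := Submodule.span P (Set.range g) with hN
  -- The kernel of the projection to `Q` is the saturation of `N`; `Q` is finite and torsion-free,
  -- hence free, and lifts of its basis provide `h`.
  let Q := ((Fin n → P) ⧸ N) ⧸ Submodule.torsion P ((Fin n → P) ⧸ N)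
  let q : (Fin n → P) →ₗ[P] Q := (Submodule.mkQ _).comp (Submodule.mkQ N)
  have hq : Function.Surjective q :=
    (Submodule.mkQ_surjective _).comp (Submodule.mkQ_surjective _)
  have hker : ∀ x, q x = 0 → ∃ d : P, d ≠ 0 ∧ d • x ∈ N := by
    intro x hx
    have hx' : Submodule.mkQ N x ∈ Submodule.torsion P ((Fin n → P) ⧸ N) :=
      (Submodule.Quotient.mk_eq_zero _).1 hx
    obtain ⟨d, hd⟩ := (Submodule.mem_torsion_iff _).1 hx'
    refine ⟨d, nonZeroDivisors.coe_ne_zero d, ?_⟩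
    rw [← Submodule.Quotient.mk_eq_zero]
    exact hd
  have hNq : ∀ x ∈ N, q x = 0 := by
    intro x hx
    have : Submodule.mkQ N x = 0 := by simpa using hx
    rw [LinearMap.comp_apply, this, map_zero]
  obtain ⟨m, b⟩ : Σ m : ℕ, Module.Basis (Fin m) P Q := Module.basisOfFiniteTypeTorsionFree'
  choose h hh using fun i => hq (b i)
  have hsplit : ∀ x, ∃ y ∈ Submodule.span P (Set.range h), q (x - y) = 0 := by
    intro x
    refine ⟨∑ i, b.repr (q x) i • h i, ?_, ?_⟩
    · exact Submodule.sum_mem _ fun i _ =>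
        Submodule.smul_mem _ _ (Submodule.subset_span ⟨i, rfl⟩)
    · simp only [map_sub, map_sum, map_smul, hh]
      rw [b.sum_repr, sub_self]
  have hspan : ∀ (x : Fin n → P), ∃ d : P, d ≠ 0 ∧
      d • x ∈ Submodule.span P (Set.range (Sum.elim g h)) := by
    intro x
    obtain ⟨y, hy, hxy⟩ := hsplit x
    obtain ⟨d, hd, hdx⟩ := hker _ hxy
    refine ⟨d, hd, ?_⟩
    rw [Set.Sum.elim_range, Submodule.span_union, show d • x = d • (x - y) + d • y by
      rw [← smul_add, sub_add_cancel]]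
    exact Submodule.add_mem_sup hdx (Submodule.smul_mem _ _ hy)
  refine ⟨m, h, le_antisymm ?_ ?_, ?_⟩
  · have hli : LinearIndependent P (Sum.elim g h) := by
      rw [Fintype.linearIndependent_iff]
      intro a ha
      rw [Fintype.sum_sum_type] at ha
      simp only [Sum.elim_inl, Sum.elim_inr] at ha
      have h0 : ∑ i, a (Sum.inl i) • g i ∈ N := Submodule.sum_mem _ fun i _ =>
        Submodule.smul_mem _ _ (Submodule.subset_span ⟨i, rfl⟩)
      have h1 := congrArg q ha
      rw [map_add, hNq _ h0, zero_add, map_zero, map_sum] at h1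
      simp only [map_smul, hh] at h1
      have h2 := Fintype.linearIndependent_iff.1 b.linearIndependent _ h1
      simp only [h2, zero_smul, Finset.sum_const_zero, add_zero] at ha
      have h3 := Fintype.linearIndependent_iff.1 hg _ ha
      rintro (i | i)
      exacts [h3 i, h2 i]
    simpa using hli.fintype_card_le_finrank
  -- Nonzero multiples of the unit vectors are `n` independent vectors in a module with `k + m`
  -- generators.
  · choose d hd hdx using fun i : Fin n => hspan (Pi.single i 1)
    have hli : LinearIndependent P fun i : Fin n => d i • (Pi.single i 1 : Fin n → P) := by
      rw [Fintype.linearIndependent_iff]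
      intro a ha i
      have := congrFun ha i
      simp only [Finset.sum_apply, Pi.smul_apply, Pi.single_apply, smul_eq_mul, mul_ite, mul_one,
        mul_zero, Finset.sum_ite_eq, Finset.mem_univ, if_true, Pi.zero_apply] at this
      exact (mul_eq_zero.1 this).resolve_right (hd i)
    let S := Submodule.span P (Set.range (Sum.elim g h))
    have hli' : LinearIndependent P fun i : Fin n =>
        (⟨d i • (Pi.single i 1 : Fin n → P), hdx i⟩ : S) :=
      LinearIndependent.of_comp S.subtype hli
    have h1 := hli'.fintype_card_le_finrank
    have h2 : Module.finrank P S ≤ _ := finrank_range_le_card (R := P) (Sum.elim g h)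
    simpa using h1.trans h2
  · intro x
    obtain ⟨y, hy, hxy⟩ := hsplit x
    obtain ⟨d, hd, hdx⟩ := hker _ hxy
    obtain ⟨c, hc, hcx⟩ := hM _ d hd hdx
    refine ⟨c, hc, ?_⟩
    rw [Set.Sum.elim_range, Submodule.span_union, show c • x = c • (x - y) + c • y by
      rw [← smul_add, sub_add_cancel]]
    exact Submodule.add_mem_sup hcx (Submodule.smul_mem _ _ hy)

/-- A matrix with independent rows over a principal ideal domain is the upper part of a square
matrix whose determinant divides a multiplier. -/
theorem exists_completion {k n : ℕ} (g : Fin k → Fin n → P) (hg : LinearIndependent P g)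
    (M : Submonoid P)
    (hM : ∀ (x : Fin n → P) (d : P), d ≠ 0 → d • x ∈ Submodule.span P (Set.range g) →
      ∃ c ∈ M, c • x ∈ Submodule.span P (Set.range g)) :
    ∃ (m : ℕ) (e : Fin k ⊕ Fin m ≃ Fin n) (W : Matrix (Fin n) (Fin n) P),
      (∀ i, W (e (Sum.inl i)) = g i) ∧ ∃ c ∈ M, W.det ∣ c := by
  obtain ⟨m, h, hkm, hsp⟩ := exists_extension g hg M hM
  let e : Fin k ⊕ Fin m ≃ Fin n := finSumFinEquiv.trans (finCongr hkm)
  let W : Matrix (Fin n) (Fin n) P := fun i => Sum.elim g h (e.symm i)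
  refine ⟨m, e, W, fun i => by simp [W], ?_⟩
  choose c hc hcx using fun i : Fin n => hsp (Pi.single i 1)
  have hrange : Set.range (Sum.elim g h) = Set.range W :=
    (e.symm.surjective.range_comp (Sum.elim g h)).symm
  have hA : ∀ i, ∃ a : Fin n → P, a ᵥ* W = (∏ l, c l) • (Pi.single i 1 : Fin n → P) := by
    intro i
    have h1 : (∏ l, c l) • (Pi.single i 1 : Fin n → P) ∈ Submodule.span P (Set.range W) := by
      rw [← hrange, ← Finset.prod_erase_mul _ _ (Finset.mem_univ i), mul_smul]
      exact Submodule.smul_mem _ _ (hcx i)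
    obtain ⟨a, ha⟩ := (Submodule.mem_span_range_iff_exists_fun P).1 h1
    exact ⟨a, by rw [Matrix.vecMul_eq_sum]; exact ha⟩
  choose A hA using hA
  refine ⟨(∏ l, c l) ^ n, pow_mem (prod_mem fun l _ => hc l) n, ?_⟩
  have hAW : Matrix.of A * W = (∏ l, c l) • (1 : Matrix (Fin n) (Fin n) P) := by
    ext i j
    have := congrFun (hA i) j
    rw [Matrix.mul_apply_eq_vecMul]
    simp only [Matrix.smul_apply, Matrix.one_apply]
    refine this.trans ?_
    simp [Pi.single_apply, eq_comm]
  refine ⟨(Matrix.of A).det, ?_⟩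
  have := congrArg Matrix.det hAW
  rw [Matrix.det_mul, Matrix.det_smul, Matrix.det_one, mul_one, Fintype.card_fin] at this
  rw [← this, mul_comm]

end Completion

/-! ### Laurent series of finite support. -/

section Laurent

variable {R : Type*} [CommRing R]

/-- The embedding of polynomials into Laurent series. -/
def toLaurentSeries (R : Type*) [CommRing R] : R[X] →+* R⸨X⸩ :=
  (HahnSeries.ofPowerSeries ℤ R).comp Polynomial.coeToPowerSeries.ringHom

theorem laurentMatrix_eq_map {k n : ℕ} (G : Matrix (Fin k) (Fin n) R[X]) :
    laurentMatrix G = G.map (toLaurentSeries R) := rfl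

theorem toLaurentSeries_coeff (f : R[X]) (j : ℤ) :
    (toLaurentSeries R f).coeff j = if j < 0 then 0 else f.coeff j.natAbs := by
  have := PowerSeries.coeff_coe (f : R⟦X⟧) j
  rw [Polynomial.coeff_coe] at this
  exact this

theorem toLaurentSeries_injective : Function.Injective (toLaurentSeries R) := by
  intro f g h
  ext j
  have := congrArg (fun x => x.coeff (j : ℤ)) h
  simpa only [toLaurentSeries_coeff, Int.natAbs_natCast, if_neg (Int.natCast_nonneg j).not_gt]
    using this

theorem toLaurentSeries_X_pow (j : ℕ) :
    toLaurentSeries R (X ^ j) = HahnSeries.single (j : ℤ) 1 := by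
  ext i
  rw [toLaurentSeries_coeff, HahnSeries.coeff_single, Polynomial.coeff_X_pow]
  split_ifs <;> first | rfl | omega

theorem finite_support_toLaurentSeries (f : R[X]) : (toLaurentSeries R f).support.Finite := by
  refine (f.support.finite_toSet.image (fun j : ℕ => (j : ℤ))).subset fun j hj => ?_
  rw [HahnSeries.mem_support, toLaurentSeries_coeff] at hj
  split_ifs at hj with h
  · exact absurd rfl hj
  · exact ⟨j.natAbs, by simpa using hj, by simp; omega⟩

theorem finite_support_mul {f g : R⸨X⸩} (hf : f.support.Finite) (hg : g.support.Finite) :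
    (f * g).support.Finite :=
  (hf.add hg).subset HahnSeries.support_mul_subset

theorem finite_support_sum {ι : Type*} (s : Finset ι) (f : ι → R⸨X⸩)
    (hf : ∀ i ∈ s, (f i).support.Finite) : (∑ i ∈ s, f i).support.Finite := by
  classical
  induction s using Finset.induction_on with
  | empty => simp
  | insert a s ha ih =>
    rw [Finset.sum_insert ha]
    exact ((hf a (Finset.mem_insert_self a s)).union
      (ih fun i hi => hf i (Finset.mem_insert_of_mem hi))).subset (HahnSeries.support_add_subset _ _)

theorem finite_support_of_X_pow_mul (j : ℕ) {f : R⸨X⸩}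
    (h : (toLaurentSeries R (X ^ j) * f).support.Finite) : f.support.Finite := by
  have h1 : f = HahnSeries.single (-(j : ℤ)) 1 * (toLaurentSeries R (X ^ j) * f) := by
    rw [toLaurentSeries_X_pow, ← mul_assoc, HahnSeries.single_mul_single, neg_add_cancel, mul_one,
      HahnSeries.single_zero_one, one_mul]
  rw [h1]
  exact finite_support_mul ((Set.finite_singleton _).subset HahnSeries.support_single_subset) h

/-- A Laurent series with finitely many terms is a polynomial up to a power of the variable. -/
theorem exists_X_pow_mul_eq {f : R⸨X⸩} (hf : f.support.Finite) :
    ∃ j₀ : ℕ, ∀ j ≥ j₀, ∃ w : R[X], toLaurentSeries R (X ^ j) * f = toLaurentSeries R w := by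
  -- The sum is a crude bound for the absolute values of all exponents.
  refine ⟨∑ i ∈ hf.toFinset, i.natAbs, fun j hj => ?_⟩
  have hle : ∀ i ∈ hf.toFinset, i.natAbs ≤ j := fun i hi =>
    (Finset.single_le_sum (f := fun i : ℤ => i.natAbs) (fun _ _ => Nat.zero_le _) hi).trans hj
  refine ⟨∑ i ∈ hf.toFinset, Polynomial.monomial (i + j).toNat (f.coeff i), ?_⟩
  ext l
  rw [toLaurentSeries_X_pow, toLaurentSeries_coeff,
    show l = (l - j) + j by ring, HahnSeries.coeff_single_mul_add, one_mul, sub_add_cancel,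
    Polynomial.finsetSum_coeff]
  simp only [Polynomial.coeff_monomial]
  split_ifs with hl
  · by_contra hne
    have := hle _ (hf.mem_toFinset.2 (HahnSeries.mem_support _ _ |>.2 hne))
    omega
  · by_cases h0 : f.coeff (l - j) = 0
    · rw [h0, Finset.sum_eq_zero]
      intro i hi
      rw [if_neg]
      intro h
      have := hle i hi
      rw [show i = l - j by omega] at hi
      exact (hf.mem_toFinset.1 hi) h0
    · have hm : l - j ∈ hf.toFinset := hf.mem_toFinset.2 h0
      rw [Finset.sum_eq_single_of_mem _ hm, if_pos (by omega)]
      intro i hi hne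
      have := hle i hi
      rw [if_neg (by omega)]

theorem wt_lt_top_iff {m : ℕ} (u : Fin m → R⸨X⸩) :
    wt u < ⊤ ↔ ∀ i, (u i).support.Finite := by
  refine (WithTop.sum_lt_top (M := ℕ)).trans ?_
  simp only [Finset.mem_univ, true_imp_iff]
  exact forall_congr' fun i => Set.encard_lt_top_iff

theorem wt_vecMul_lt_top {k n : ℕ} {u : Fin k → R⸨X⸩} (hu : wt u < ⊤)
    (G : Matrix (Fin k) (Fin n) R[X]) : wt (u ᵥ* laurentMatrix G) < ⊤ := by
  rw [wt_lt_top_iff] at hu ⊢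
  exact fun j => finite_support_sum _ _ fun i _ =>
    finite_support_mul (hu i) (finite_support_toLaurentSeries _)

theorem exists_X_pow_mul_eq_pi {k : ℕ} {u : Fin k → R⸨X⸩} (hu : wt u < ⊤) :
    ∃ (j : ℕ) (w : Fin k → R[X]), ∀ i,
      toLaurentSeries R (X ^ j) * u i = toLaurentSeries R (w i) := by
  rw [wt_lt_top_iff] at hu
  choose j hj using fun i => exists_X_pow_mul_eq (hu i)
  choose w hw using fun i =>
    hj i (∑ l, j l) (Finset.single_le_sum (fun _ _ => Nat.zero_le _) (Finset.mem_univ i))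
  exact ⟨_, w, hw⟩

end Laurent

/-! ### Parity-check matrices from adjugates. -/

section Duality

variable {R : Type*} [CommRing R] {k m n : ℕ}

theorem linearIndependent_rows_iff {A : Type*} [CommRing A] {M : Matrix (Fin k) (Fin n) A} :
    LinearIndependent A (fun i => M i) ↔ ∀ u : Fin k → A, u ᵥ* M = 0 → u = 0 := by
  rw [Fintype.linearIndependent_iff]
  refine forall_congr' fun u => ?_
  rw [Matrix.vecMul_eq_sum, funext_iff (f := u)]
  rfl

/-- The upper rows of a square matrix. -/
def upper {A : Type*} (e : Fin k ⊕ Fin m ≃ Fin n) (W : Matrix (Fin n) (Fin n) A) :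
    Matrix (Fin k) (Fin n) A :=
  W.submatrix (e ∘ Sum.inl) id

/-- The lower rows of a square matrix. -/
def lower {A : Type*} (e : Fin k ⊕ Fin m ≃ Fin n) (W : Matrix (Fin n) (Fin n) A) :
    Matrix (Fin m) (Fin n) A :=
  W.submatrix (e ∘ Sum.inr) id

theorem vecMul_upper_add_vecMul_lower {A : Type*} [CommRing A] (e : Fin k ⊕ Fin m ≃ Fin n)
    (W : Matrix (Fin n) (Fin n) A) (x : Fin n → A) :
    (fun i => x (e (Sum.inl i))) ᵥ* upper e W + (fun i => x (e (Sum.inr i))) ᵥ* lower e W =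
      x ᵥ* W := by
  ext j
  simp only [Pi.add_apply, Matrix.vecMul, dotProduct, upper, lower, Matrix.submatrix_apply,
    Function.comp_apply, id]
  rw [← e.sum_comp, Fintype.sum_sum_type]

/-- Extension of a vector by zero. -/
def extendZero {A : Type*} [Zero A] (e : Fin k ⊕ Fin m ≃ Fin n) (u : Fin m → A) : Fin n → A :=
  fun i => Sum.elim 0 u (e.symm i)

theorem vecMul_lower {A : Type*} [CommRing A] (e : Fin k ⊕ Fin m ≃ Fin n)
    (W : Matrix (Fin n) (Fin n) A) (u : Fin m → A) :
    u ᵥ* lower e W = extendZero e u ᵥ* W := by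
  rw [← vecMul_upper_add_vecMul_lower e W (extendZero e u)]
  simp only [extendZero, Equiv.symm_apply_apply, Sum.elim_inl, Sum.elim_inr, Pi.zero_apply]
  rw [show (fun _ : Fin k => (0 : A)) = 0 from rfl, Matrix.zero_vecMul, zero_add]

theorem mem_dual_iff {C : Submodule R⸨X⸩ (Fin n → R⸨X⸩)} {G : Matrix (Fin k) (Fin n) R[X]}
    (hG : IsEncoder G C) (v : Fin n → R⸨X⸩) :
    v ∈ dual C ↔ laurentMatrix G *ᵥ v = 0 := by
  constructor
  · intro hv
    ext1 i
    have := hv (laurentMatrix G i) ((hG.2 _).2 ⟨Pi.single i 1, by simp; rfl⟩)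
    rwa [dotProduct_comm] at this
  · intro hv w hw
    obtain ⟨u, rfl⟩ := (hG.2 _).1 hw
    rw [dotProduct_comm, ← Matrix.dotProduct_mulVec, hv, dotProduct_zero]

/-- The parity-check matrix that a square completion of an encoder provides. -/
def parityCheck (e : Fin k ⊕ Fin m ≃ Fin n) (W : Matrix (Fin n) (Fin n) R[X]) :
    Matrix (Fin m) (Fin n) R[X] :=
  lower e W.adjugateᵀ

theorem vecMul_parityCheck (e : Fin k ⊕ Fin m ≃ Fin n) (W : Matrix (Fin n) (Fin n) R[X])
    (u : Fin m → R⸨X⸩) :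
    u ᵥ* laurentMatrix (parityCheck e W) =
      (W.map (toLaurentSeries R)).adjugate *ᵥ extendZero e u := by
  rw [← Matrix.vecMul_transpose, ← vecMul_lower]
  have : (W.map (toLaurentSeries R)).adjugate = W.adjugate.map (toLaurentSeries R) :=
    ((toLaurentSeries R).map_adjugate W).symm
  rw [this]
  rfl

/-- The upper coordinates express orthogonality to the rows of the encoder; the lower ones recover
`u` up to the factor `det W`. -/
theorem mulVec_vecMul_parityCheck (e : Fin k ⊕ Fin m ≃ Fin n) (W : Matrix (Fin n) (Fin n) R[X])
    (u : Fin m → R⸨X⸩) :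
    W.map (toLaurentSeries R) *ᵥ (u ᵥ* laurentMatrix (parityCheck e W)) =
      toLaurentSeries R W.det • extendZero e u := by
  rw [vecMul_parityCheck, Matrix.mulVec_mulVec, Matrix.mul_adjugate, Matrix.smul_mulVec,
    Matrix.one_mulVec, RingHom.map_det]
  rfl

theorem isEncoder_parityCheck {C : Submodule R⸨X⸩ (Fin n → R⸨X⸩)}
    (e : Fin k ⊕ Fin m ≃ Fin n) (W : Matrix (Fin n) (Fin n) R[X])
    (hG : IsEncoder (upper e W) C) (hW : IsUnit (toLaurentSeries R W.det)) :
    IsEncoder (parityCheck e W) (dual C) := by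
  have hdet : (W.map (toLaurentSeries R)).det = toLaurentSeries R W.det :=
    ((toLaurentSeries R).map_det W).symm
  obtain ⟨c, hc⟩ := hW.exists_left_inv
  constructor
  · rw [linearIndependent_rows_iff]
    intro u hu
    have h := mulVec_vecMul_parityCheck e W u
    rw [hu, Matrix.mulVec_zero] at h
    ext1 i
    have h' := congrFun h (e (Sum.inr i))
    simp only [Pi.zero_apply, Pi.smul_apply, smul_eq_mul, extendZero, Equiv.symm_apply_apply,
      Sum.elim_inr] at h'
    rw [← one_mul (u i), ← hc, mul_assoc, ← h', mul_zero, Pi.zero_apply]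
  · intro v
    rw [mem_dual_iff hG]
    constructor
    · intro hv
      refine ⟨fun i => c * (W.map (toLaurentSeries R) *ᵥ v) (e (Sum.inr i)), ?_⟩
      rw [vecMul_parityCheck]
      have : extendZero e (fun i => c * (W.map (toLaurentSeries R) *ᵥ v) (e (Sum.inr i))) =
          c • (W.map (toLaurentSeries R) *ᵥ v) := by
        ext1 i
        obtain ⟨i, rfl⟩ := e.surjective i
        rcases i with i | i
        · have h0 : (W.map (toLaurentSeries R) *ᵥ v) (e (Sum.inl i)) = 0 := congrFun hv i
          simp [extendZero, h0]
        · simp [extendZero]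
      rw [this, Matrix.mulVec_smul, Matrix.mulVec_mulVec, Matrix.adjugate_mul,
        Matrix.smul_mulVec, Matrix.one_mulVec, hdet, smul_smul, hc, one_smul]
    · rintro ⟨u, rfl⟩
      ext1 i
      have := congrFun (mulVec_vecMul_parityCheck e W u) (e (Sum.inl i))
      simp only [Pi.smul_apply, extendZero, Equiv.symm_apply_apply, Sum.elim_inl,
        Pi.zero_apply, smul_zero] at this
      exact this

theorem dual_dual_eq {C : Submodule R⸨X⸩ (Fin n → R⸨X⸩)}
    (e : Fin k ⊕ Fin m ≃ Fin n) (W : Matrix (Fin n) (Fin n) R[X])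
    (hG : IsEncoder (upper e W) C) (hW : IsUnit (toLaurentSeries R W.det)) :
    dual (dual C) = C := by
  have hdet : (W.map (toLaurentSeries R)).det = toLaurentSeries R W.det :=
    ((toLaurentSeries R).map_det W).symm
  have hadj : (W.map (toLaurentSeries R)).adjugate = W.adjugate.map (toLaurentSeries R) :=
    ((toLaurentSeries R).map_adjugate W).symm
  obtain ⟨c, hc⟩ := hW.exists_left_inv
  refine le_antisymm (fun v hv => ?_) fun v hv w hw => ?_
  · rw [mem_dual_iff (isEncoder_parityCheck e W hG hW)] at hv
    -- `x` is `v` times the inverse of `W`; its lower coordinates are multiples of the parity checks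
    -- of `v`, so only upper rows contribute to `v`.
    set x : Fin n → R⸨X⸩ := c • (v ᵥ* (W.map (toLaurentSeries R)).adjugate) with hx
    have hv' : x ᵥ* W.map (toLaurentSeries R) = v := by
      rw [hx, Matrix.smul_vecMul, Matrix.vecMul_vecMul, Matrix.adjugate_mul, Matrix.vecMul_smul,
        Matrix.vecMul_one, hdet, smul_smul, hc, one_smul]
    have h0 : (fun i => x (e (Sum.inr i))) = 0 := by
      ext1 i
      have h1 : (v ᵥ* (W.map (toLaurentSeries R)).adjugate) (e (Sum.inr i)) = 0 := by
        rw [← Matrix.mulVec_transpose, hadj]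
        exact congrFun hv i
      rw [hx, Pi.smul_apply, h1, smul_zero, Pi.zero_apply]
    rw [hG.2, ← hv', ← vecMul_upper_add_vecMul_lower e, h0, Matrix.zero_vecMul, add_zero]
    exact ⟨_, rfl⟩
  · rw [dotProduct_comm]
    exact hw v hv

theorem isNoncatastrophicEncoder_parityCheck (e : Fin k ⊕ Fin m ≃ Fin n)
    (W : Matrix (Fin n) (Fin n) R[X]) {j : ℕ} (hW : W.det ∣ X ^ j) :
    IsNoncatastrophicEncoder (parityCheck e W) := by
  refine fun u => ⟨fun hu => ?_, fun hu => wt_vecMul_lt_top hu _⟩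
  obtain ⟨q, hq⟩ := hW
  have h := wt_vecMul_lt_top hu Wᵀ
  rw [laurentMatrix_eq_map Wᵀ, Matrix.transpose_map, Matrix.vecMul_transpose,
    mulVec_vecMul_parityCheck, wt_lt_top_iff] at h
  rw [wt_lt_top_iff]
  intro i
  refine finite_support_of_X_pow_mul j ?_
  have h' := finite_support_mul (finite_support_toLaurentSeries q) (h (e (Sum.inr i)))
  rwa [Pi.smul_apply, smul_eq_mul, ← mul_assoc, ← map_mul, mul_comm q, ← hq, extendZero,
    Equiv.symm_apply_apply, Sum.elim_inr] at h'

end Duality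

/-! ### Reduction to the residue field and lifting along a nilpotent kernel. -/

section Reduction

variable {R F : Type*} [CommRing R] [Field F] (φ : R →+* F)

/-- Coefficientwise application of a ring homomorphism to Laurent series. -/
def mapLaurent : R⸨X⸩ →+* F⸨X⸩ where
  toFun f := f.map (φ : R →ₙ+* F)
  map_zero' := by ext; simp
  map_one' := by
    ext i
    change φ (HahnSeries.coeff 1 i) = _
    rw [HahnSeries.coeff_one, HahnSeries.coeff_one, apply_ite φ, map_one, map_zero]
  map_add' f g := by ext j; exact map_add φ (f.coeff j) (g.coeff j)
  map_mul' f g := HahnSeries.map_mul (φ : R →ₙ+* F)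

theorem mapLaurent_coeff (f : R⸨X⸩) (j : ℤ) : (mapLaurent φ f).coeff j = φ (f.coeff j) := rfl

theorem mapLaurent_toLaurentSeries (f : R[X]) :
    mapLaurent φ (toLaurentSeries R f) = toLaurentSeries F (f.map φ) := by
  ext j
  rw [mapLaurent_coeff, toLaurentSeries_coeff, toLaurentSeries_coeff]
  split_ifs <;> simp

variable {φ}

theorem mapLaurent_surjective (hφ : Function.Surjective φ) :
    Function.Surjective (mapLaurent φ) := by
  classical
  intro f
  -- Zero must lift to zero, so that the support stays well-ordered.
  let g : ZeroHom F R :=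
    ⟨fun a => if a = 0 then 0 else Function.surjInv hφ a, if_pos rfl⟩
  refine ⟨f.map g, ?_⟩
  ext j
  rw [mapLaurent_coeff, HahnSeries.map_coeff]
  change φ (if f.coeff j = 0 then 0 else _) = _
  split_ifs with h
  · rw [h, map_zero]
  · exact Function.surjInv_eq hφ _

theorem support_C_mul_eq {s : R} (hs : ∀ a, s * a = 0 ↔ φ a = 0) (f : R⸨X⸩) :
    (HahnSeries.C s * f).support = (mapLaurent φ f).support := by
  ext j
  simp only [HahnSeries.mem_support, HahnSeries.C_mul_eq_smul, HahnSeries.coeff_smul, smul_eq_mul, mapLaurent_coeff, ne_eq,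
    hs]

theorem C_mul_eq_zero_iff_mapLaurent {s : R} (hs : ∀ a, s * a = 0 ↔ φ a = 0) (f : R⸨X⸩) :
    HahnSeries.C s * f = 0 ↔ mapLaurent φ f = 0 := by
  rw [← HahnSeries.support_eq_empty_iff, support_C_mul_eq hs, HahnSeries.support_eq_empty_iff]

/-- If `g` lifts the inverse of the reduction of `f`, then `f * g - 1` is a multiple of the
nilpotent constant `t`. -/
theorem isUnit_of_mapLaurent_ne_zero (hφ : Function.Surjective φ) {t : R} (ht : IsNilpotent t)
    (hker : ∀ a, φ a = 0 → t ∣ a) {f : R⸨X⸩} (hf : mapLaurent φ f ≠ 0) : IsUnit f := by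
  classical
  obtain ⟨g, hg⟩ := mapLaurent_surjective hφ (mapLaurent φ f)⁻¹
  have h1 : mapLaurent φ (f * g - 1) = 0 := by
    rw [map_sub, map_mul, hg, mul_inv_cancel₀ hf, map_one, sub_self]
  have hdvd : ∀ j, ∃ b, (f * g - 1).coeff j = t * b := fun j =>
    hker _ (congrArg (fun x => x.coeff j) h1)
  choose b hb using hdvd
  let y : R⸨X⸩ :=
    ⟨fun j => if (f * g - 1).coeff j = 0 then 0 else b j,
      (f * g - 1).isPWO_support'.mono fun j hj h => hj (if_pos h)⟩
  have hy : f * g - 1 = HahnSeries.C t * y := by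
    ext j
    rw [HahnSeries.C_mul_eq_smul, HahnSeries.coeff_smul]
    change _ = t * (if _ then _ else _)
    split_ifs with h
    · rw [h, mul_zero]
    · exact hb j
  have hnil : IsNilpotent (f * g - 1) := by
    rw [hy]
    exact (Commute.all _ _).isNilpotent_mul_right (ht.map HahnSeries.C)
  have := hnil.isUnit_add_one
  rw [sub_add_cancel] at this
  exact isUnit_of_mul_isUnit_left this

theorem dvd_pow_of_map_dvd_X_pow (hφ : Function.Surjective φ) {t : R} (ht : IsNilpotent t)
    (hker : ∀ a, φ a = 0 → t ∣ a) {f : R[X]} {j : ℕ} (hf : f.map φ ∣ X ^ j) :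
    ∃ N, f ∣ X ^ N := by
  obtain ⟨q, hq⟩ := hf
  obtain ⟨q, rfl⟩ := Polynomial.map_surjective φ hφ q
  have h : C t ∣ X ^ j - f * q := by
    rw [Polynomial.C_dvd_iff_dvd_coeff]
    intro i
    apply hker
    rw [← Polynomial.coeff_map, Polynomial.map_sub, Polynomial.map_mul, Polynomial.map_pow,
      Polynomial.map_X, hq, sub_self, Polynomial.coeff_zero]
  obtain ⟨y, hy⟩ := h
  obtain ⟨N, hN⟩ := ht
  refine ⟨j * N, ?_⟩
  -- `f * q = X ^ j - C t * y` divides the difference of the `N`-th powers, where the second power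
  -- vanishes.
  have h2 := sub_dvd_pow_sub_pow (X ^ j : R[X]) (C t * y) N
  rw [mul_pow (C t), ← C_pow, hN, C_0, zero_mul, sub_zero, ← pow_mul, ← hy, sub_sub_cancel] at h2
  exact (dvd_mul_right _ _).trans h2

end Reduction

/-! ### Completing encoders, and the theorem over a ring with nilpotent residue kernel. -/

section Encoders

variable {R F : Type*} [CommRing R] [Field F] {φ : R →+* F} {k n : ℕ}

theorem mapLaurent_vecMul (φ : R →+* F) (u : Fin k → R⸨X⸩) (G : Matrix (Fin k) (Fin n) R[X])
    (j : Fin n) :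
    mapLaurent φ ((u ᵥ* laurentMatrix G) j) =
      ((fun i => mapLaurent φ (u i)) ᵥ* laurentMatrix (G.map (Polynomial.map φ))) j := by
  simp only [Matrix.vecMul, dotProduct, map_sum, map_mul]
  exact Finset.sum_congr rfl fun i _ => congrArg _ (mapLaurent_toLaurentSeries φ (G i j))

theorem toLaurentSeries_vecMul (u : Fin k → R[X]) (G : Matrix (Fin k) (Fin n) R[X])
    (j : Fin n) :
    toLaurentSeries R ((u ᵥ* G) j) =
      ((fun i => toLaurentSeries R (u i)) ᵥ* laurentMatrix G) j :=
  RingHom.map_vecMul (toLaurentSeries R) G u j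

/-- A relation between the reduced rows, lifted and multiplied by `s`, becomes a relation between
the rows of `G`. -/
theorem linearIndependent_map (hφ : Function.Surjective φ) {s : R}
    (hs : ∀ a, s * a = 0 ↔ φ a = 0) {G : Matrix (Fin k) (Fin n) R[X]}
    (hG : LinearIndependent R⸨X⸩ (fun i => laurentMatrix G i)) :
    LinearIndependent F[X] (fun i => G.map (Polynomial.map φ) i) := by
  rw [linearIndependent_rows_iff] at hG ⊢
  intro a ha
  choose b hb using fun i => Polynomial.map_surjective φ hφ (a i)
  have h1 : ((HahnSeries.C s : R⸨X⸩) • fun i => toLaurentSeries R (b i)) ᵥ* laurentMatrix G = 0 := by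
    rw [Matrix.smul_vecMul]
    ext1 j
    rw [Pi.smul_apply, Pi.zero_apply, smul_eq_mul, C_mul_eq_zero_iff_mapLaurent hs, mapLaurent_vecMul]
    simp only [mapLaurent_toLaurentSeries, hb]
    rw [← toLaurentSeries_vecMul, ha, Pi.zero_apply, map_zero]
  ext1 i
  have h2 := congrFun (hG _ h1) i
  rw [Pi.smul_apply, Pi.zero_apply, smul_eq_mul, C_mul_eq_zero_iff_mapLaurent hs, mapLaurent_toLaurentSeries,
    hb] at h2
  exact toLaurentSeries_injective (h2.trans (map_zero _).symm)

/-- Modulo the maximal ideal, the row module of a noncatastrophic encoder is saturated up to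
powers of the variable. -/
theorem exists_X_pow_smul_mem_span (hφ : Function.Surjective φ) {s t : R}
    (hs : ∀ a, s * a = 0 ↔ φ a = 0) (ht : IsNilpotent t) (hker : ∀ a, φ a = 0 → t ∣ a)
    {G : Matrix (Fin k) (Fin n) R[X]} (hG : IsNoncatastrophicEncoder G)
    (x : Fin n → F[X]) (d : F[X]) (hd : d ≠ 0)
    (hx : d • x ∈ Submodule.span F[X] (Set.range fun i => G.map (Polynomial.map φ) i)) :
    ∃ c ∈ Submonoid.powers (X : F[X]),
      c • x ∈ Submodule.span F[X] (Set.range fun i => G.map (Polynomial.map φ) i) := by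
  obtain ⟨a, ha⟩ := (Submodule.mem_span_range_iff_exists_fun _).1 hx
  have ha' : a ᵥ* G.map (Polynomial.map φ) = d • x := by
    rw [Matrix.vecMul_eq_sum]; exact ha
  choose b hb using fun i => Polynomial.map_surjective φ hφ (a i)
  obtain ⟨d, rfl⟩ := Polynomial.map_surjective φ hφ d
  -- Inverting the lift of `d` exhibits `x` as the reduction of a codeword whose message may have
  -- infinite weight.
  have hu : IsUnit (toLaurentSeries R d) := by
    refine isUnit_of_mapLaurent_ne_zero hφ ht hker ?_
    rw [mapLaurent_toLaurentSeries]
    exact fun h => hd (toLaurentSeries_injective (h.trans (map_zero _).symm))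
  obtain ⟨c, hc⟩ := hu.exists_left_inv
  have hc' := congrArg (mapLaurent φ) hc
  rw [map_mul, mapLaurent_toLaurentSeries, map_one] at hc'
  have h1 : ∀ j, mapLaurent φ (((c • fun i => toLaurentSeries R (b i)) ᵥ* laurentMatrix G) j) =
      toLaurentSeries F (x j) := by
    intro j
    rw [Matrix.smul_vecMul, Pi.smul_apply, smul_eq_mul, map_mul, mapLaurent_vecMul]
    simp only [mapLaurent_toLaurentSeries, hb]
    rw [← toLaurentSeries_vecMul, ha', Pi.smul_apply, smul_eq_mul, map_mul, ← mul_assoc, hc',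
      one_mul]
  -- Multiplied by `s`, the codeword has the finite support of `x`. Noncatastrophicity then makes
  -- the reduced message finite, hence polynomial after a shift by `X ^ l`.
  have h2 : wt (((HahnSeries.C s : R⸨X⸩) • c • fun i => toLaurentSeries R (b i)) ᵥ* laurentMatrix G) < ⊤ := by
    rw [wt_lt_top_iff]
    intro j
    rw [Matrix.smul_vecMul, Pi.smul_apply, smul_eq_mul, support_C_mul_eq hs, h1]
    exact finite_support_toLaurentSeries _
  rw [hG, wt_lt_top_iff] at h2
  have h3 : wt (fun i => mapLaurent φ ((c • fun i => toLaurentSeries R (b i)) i)) < ⊤ := by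
    rw [wt_lt_top_iff]
    intro i
    have := h2 i
    rwa [Pi.smul_apply, smul_eq_mul, support_C_mul_eq hs] at this
  obtain ⟨l, w, hw⟩ := exists_X_pow_mul_eq_pi h3
  refine ⟨X ^ l, ⟨l, rfl⟩, (Submodule.mem_span_range_iff_exists_fun _).2 ⟨w, ?_⟩⟩
  have h4 : w ᵥ* G.map (Polynomial.map φ) = (X ^ l : F[X]) • x := by
    ext1 j
    apply toLaurentSeries_injective
    rw [toLaurentSeries_vecMul, Pi.smul_apply, smul_eq_mul, map_mul, ← h1, mapLaurent_vecMul]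
    simp only [← hw]
    exact congrFun (Matrix.smul_vecMul (toLaurentSeries F (X ^ l)) _ _) j
  rw [← h4, Matrix.vecMul_eq_sum]

/-- A completion of the reduction of a matrix lifts to a completion of the matrix. -/
theorem exists_lift_completion {m : ℕ} (hφ : Function.Surjective φ)
    (G : Matrix (Fin k) (Fin n) R[X]) (e : Fin k ⊕ Fin m ≃ Fin n)
    (V : Matrix (Fin n) (Fin n) F[X])
    (hV : ∀ i, V (e (Sum.inl i)) = G.map (Polynomial.map φ) i) :
    ∃ W : Matrix (Fin n) (Fin n) R[X], upper e W = G ∧ W.det.map φ = V.det := by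
  choose b hb using fun i j => Polynomial.map_surjective φ hφ (V i j)
  refine ⟨Matrix.of fun i => Sum.elim (fun l => G l) (fun l => b (e (Sum.inr l))) (e.symm i),
    ?_, ?_⟩
  · ext1 i j
    simp [upper]
  · rw [← Polynomial.coe_mapRingHom, RingHom.map_det]
    congr 1
    ext1 i j
    obtain ⟨i, rfl⟩ := e.surjective i
    rcases i with i | i
    · simp [hV]
    · simp [hb]

theorem exists_completion_of_isEncoder (hφ : Function.Surjective φ) {s t : R}
    (hs : ∀ a, s * a = 0 ↔ φ a = 0) (ht : IsNilpotent t) (hker : ∀ a, φ a = 0 → t ∣ a)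
    {C : Submodule R⸨X⸩ (Fin n → R⸨X⸩)} {G : Matrix (Fin k) (Fin n) R[X]} (hG : IsEncoder G C) :
    ∃ (m : ℕ) (e : Fin k ⊕ Fin m ≃ Fin n) (W : Matrix (Fin n) (Fin n) R[X]),
      upper e W = G ∧ IsUnit (toLaurentSeries R W.det) := by
  obtain ⟨m, e, V, hV, c, hc, hVc⟩ := exists_completion _ (linearIndependent_map hφ hs hG.1)
    -- With all nonzero polynomials allowed as multipliers, the saturation condition is vacuous.
    (nonZeroDivisors F[X]) fun x d hd hx => ⟨d, mem_nonZeroDivisors_of_ne_zero hd, hx⟩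
  obtain ⟨W, hW, hdet⟩ := exists_lift_completion hφ G e V hV
  refine ⟨m, e, W, hW, isUnit_of_mapLaurent_ne_zero hφ ht hker ?_⟩
  rw [mapLaurent_toLaurentSeries, hdet]
  intro h
  have h0 : V.det = 0 := toLaurentSeries_injective (h.trans (map_zero _).symm)
  rw [h0, zero_dvd_iff] at hVc
  exact nonZeroDivisors.ne_zero hc hVc

theorem exists_completion_of_isNoncatastrophicEncoder (hφ : Function.Surjective φ) {s t : R}
    (hs : ∀ a, s * a = 0 ↔ φ a = 0) (ht : IsNilpotent t) (hker : ∀ a, φ a = 0 → t ∣ a)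
    {C : Submodule R⸨X⸩ (Fin n → R⸨X⸩)} {G : Matrix (Fin k) (Fin n) R[X]} (hG : IsEncoder G C)
    (hnc : IsNoncatastrophicEncoder G) :
    ∃ (m : ℕ) (e : Fin k ⊕ Fin m ≃ Fin n) (W : Matrix (Fin n) (Fin n) R[X]),
      upper e W = G ∧ ∃ j : ℕ, W.det ∣ X ^ j := by
  obtain ⟨m, e, V, hV, c, ⟨j, rfl⟩, hVc⟩ := exists_completion _
    (linearIndependent_map hφ hs hG.1) (Submonoid.powers (X : F[X]))
    (exists_X_pow_smul_mem_span hφ hs ht hker hnc)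
  obtain ⟨W, hW, hdet⟩ := exists_lift_completion hφ G e V hV
  refine ⟨m, e, W, hW, dvd_pow_of_map_dvd_X_pow hφ ht hker (j := j) ?_⟩
  rw [hdet]
  exact hVc

theorem isUnit_toLaurentSeries_of_dvd_X_pow {f : R[X]} {j : ℕ} (hf : f ∣ X ^ j) :
    IsUnit (toLaurentSeries R f) := by
  refine isUnit_of_dvd_unit (map_dvd (toLaurentSeries R) hf) ?_
  rw [toLaurentSeries_X_pow]
  refine IsUnit.of_mul_eq_one (HahnSeries.single (-(j : ℤ)) 1) ?_
  rw [HahnSeries.single_mul_single, add_neg_cancel, mul_one, HahnSeries.single_zero_one]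

theorem not_isCatastrophic_dual (hφ : Function.Surjective φ) {s t : R}
    (hs : ∀ a, s * a = 0 ↔ φ a = 0) (ht : IsNilpotent t) (hker : ∀ a, φ a = 0 → t ∣ a)
    {C : Submodule R⸨X⸩ (Fin n → R⸨X⸩)} (hC : ¬ IsCatastrophic C) :
    ¬ IsCatastrophic (dual C) := by
  simp only [IsCatastrophic, not_forall, not_not] at hC ⊢
  obtain ⟨k, G, hG, hnc⟩ := hC
  obtain ⟨m, e, W, rfl, j, hj⟩ :=
    exists_completion_of_isNoncatastrophicEncoder hφ hs ht hker hG hnc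
  exact ⟨m, parityCheck e W,
    isEncoder_parityCheck e W hG (isUnit_toLaurentSeries_of_dvd_X_pow hj),
    isNoncatastrophicEncoder_parityCheck e W hj⟩

theorem isFreeCode_dual_and_isCatastrophic_iff (hφ : Function.Surjective φ) {s t : R}
    (hs : ∀ a, s * a = 0 ↔ φ a = 0) (ht : IsNilpotent t) (hker : ∀ a, φ a = 0 → t ∣ a)
    {C : Submodule R⸨X⸩ (Fin n → R⸨X⸩)} (hC : IsFreeCode k C) :
    IsFreeCode (n - k) (dual C) ∧ (IsCatastrophic C ↔ IsCatastrophic (dual C)) := by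
  obtain ⟨G, hG⟩ := hC
  obtain ⟨m, e, W, rfl, hW⟩ := exists_completion_of_isEncoder hφ hs ht hker hG
  have hkm : k + m = n := by simpa using Fintype.card_congr e
  obtain rfl : m = n - k := by omega
  refine ⟨⟨parityCheck e W, isEncoder_parityCheck e W hG hW⟩, ?_⟩
  rw [← not_iff_not]
  refine ⟨not_isCatastrophic_dual hφ hs ht hker, fun h => ?_⟩
  rw [← dual_dual_eq e W hG hW]
  exact not_isCatastrophic_dual hφ hs ht hker h

end Encoders

end ConvCode

/-! ### The residue map of `ℤ/p^r`, with `s = p^(r-1)` and `t = p`. -/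

theorem ZMod.pow_mul_eq_zero_iff_castHom {p r : ℕ} (hp : p.Prime) (hr : 0 < r)
    (a : ZMod (p ^ r)) :
    (p : ZMod (p ^ r)) ^ (r - 1) * a = 0 ↔
      ZMod.castHom (dvd_pow_self p hr.ne') (ZMod p) a = 0 := by
  obtain ⟨a, rfl⟩ := ZMod.intCast_surjective a
  rw [map_intCast, ZMod.intCast_zmod_eq_zero_iff_dvd]
  have h : (p : ZMod (p ^ r)) ^ (r - 1) * (a : ZMod (p ^ r)) =
      (((p : ℤ) ^ (r - 1) * a : ℤ) : ZMod (p ^ r)) := by push_cast; rfl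
  rw [h, ZMod.intCast_zmod_eq_zero_iff_dvd]
  obtain ⟨r, rfl⟩ := Nat.exists_eq_succ_of_ne_zero hr.ne'
  push_cast
  rw [Nat.succ_eq_add_one, pow_succ]
  exact mul_dvd_mul_iff_left (pow_ne_zero _ (by exact_mod_cast hp.ne_zero))

theorem ZMod.natCast_dvd_of_castHom_eq_zero {p m : ℕ} (h : p ∣ m) (a : ZMod m)
    (ha : ZMod.castHom h (ZMod p) a = 0) : (p : ZMod m) ∣ a := by
  obtain ⟨a, rfl⟩ := ZMod.intCast_surjective a
  rw [map_intCast, ZMod.intCast_zmod_eq_zero_iff_dvd] at ha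
  simpa using map_dvd (Int.castRingHom (ZMod m)) ha

end

theorem mainTheorem5 (p r : ℕ) (hp : p.Prime) (hr : 0 < r) (n k : ℕ)
    (C : Submodule (LaurentSeries (ZMod (p ^ r))) (Fin n → LaurentSeries (ZMod (p ^ r))))
    (hC : ConvCode.IsFreeCode k C) :
    ConvCode.IsFreeCode (n - k) (ConvCode.dual C) ∧
      (ConvCode.IsCatastrophic C ↔ ConvCode.IsCatastrophic (ConvCode.dual C)) := by
  have : Fact p.Prime := ⟨hp⟩
  refine ConvCode.isFreeCode_dual_and_isCatastrophic_iff
    (φ := ZMod.castHom (dvd_pow_self p hr.ne') (ZMod p)) (ZMod.ringHom_surjective _)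
    (ZMod.pow_mul_eq_zero_iff_castHom hp hr) (t := p) ⟨r, ?_⟩
    (ZMod.natCast_dvd_of_castHom_eq_zero _) hC
  rw [← Nat.cast_pow, ZMod.natCast_self]
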